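/- Consider a game with players $i\in\{1,\dots,N\}$, action sets $\mathbb{R}^{n_i}$ and costs $J_i:\mathbb{R}^n\to\mathbb{R}$, where $n=\sum_i n_i$. Assume that each $J_i$ is $C^1$ and that, for every fixed $x_{-i}$, the map $x_i\mapsto J_i(x_i,x_{-i})$ is convex and radially unbounded. A profile $x^*$ is a Nash equilibrium if $J_i(x_i^*,x_{-i}^*)\le J_i(y_i,x_{-i}^*)$ for all $i$ and all $y_i\in\mathbb{R}^{n_i}$. For $x\in\mathbb{R}^n$ let $F(x)=(\nabla_{x_i}J_i(x))_{i}$ be the pseudo-gradient. For $\mathbf{x}=(\mathbf{x}^1,\dots,\mathbf{x}^N)\in(\mathbb{R}^{n})^N$ let $\mathbf{F}(\mathbf{x})=(\nabla_{x_i}J_i(\mathbf{x}^i))_{i}\in\mathbb{R}^n$ be the extended pseudo-gradient, and let $\mathcal{R}^T:\mathbb{R}^n\to(\mathbb{R}^n)^N$ be the linear map with $(\mathcal{R}^Tx)^i_i=x_i$ and $(\mathcal{R}^Tx)^i_j=0$ for $j\ne i$. Assume that $F$ is monotone, $\langle x-x',F(x)-F(x')\rangle\ge 0$ for all $x,x'\in\mathbb{R}^n$,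 and that the extended pseudo-gradient is monotone, $\langle\mathbf{x}-\mathbf{x}',\mathcal{R}^T(\mathbf{F}(\mathbf{x})-\mathbf{F}(\mathbf{x}'))\rangle\ge 0$ for all $\mathbf{x},\mathbf{x}'\in(\mathbb{R}^n)^N$. Let $G$ be a connected undirected graph on the set of players, with symmetric weights $w_{ij}=w_{ji}$, where $w_{ij}>0$ if $i$ and $j$ are adjacent and $w_{ij}=0$ otherwise. Let $L=\mathrm{diag}\big(\sum_j w_{ij}\big)_i-(w_{ij})_{i,j}$ be its weighted Laplacian and $\mathbf{L}=L\otimes I_n$. For any $\alpha,\beta,c>0$ consider the dynamics $$\dot{\mathbf{r}}=\alpha(\mathbf{x}-\mathbf{r}),\qquad \dot{\mathbf{x}}=-\mathcal{R}^T\mathbf{F}(\mathbf{x})-\beta(\mathbf{x}-\mathbf{r})-c\,\mathbf{L}\mathbf{x}\qquad(t\ge 0).$$ Then for every initial condition there is a solution defined for all $t\ge 0$, and every solution $(\mathbf{x}(t),\mathbf{r}(t))$ on $[0,\infty)$ converges, as $t\to\infty$, to $(\mathbf{1}_N\otimes x^*,\mathbf{1}_N\otimes x^*)$ for some Nash equilibrium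 $x^*$ of the game (which may depend on the solution). -/

import Mathlib

open Filter Topology

namespace HeavyAnchor

noncomputable section

/-- The action space `ℝ^{n_i}` of player `i`; the players are the elements of `Fin N`. -/
abbrev Action {N : ℕ} (n : Fin N → ℕ) (i : Fin N) : Type := EuclideanSpace ℝ (Fin (n i))

/-- Action profiles `x = (x_1, …, x_N)`, i.e. `ℝ^{n_1} × ⋯ × ℝ^{n_N}` with the Euclidean structure. -/
abbrev Profile {N : ℕ} (n : Fin N → ℕ) : Type := PiLp 2 (Action n)

/-- Stacked estimates `𝐱 = (𝐱^1, …, 𝐱^N)`: `𝐱 i : Profile n` is the estimate held by agent `i`,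
and `𝐱 i j` is the estimate by agent `i` of the action of player `j`. -/
abbrev Stack {N : ℕ} (n : Fin N → ℕ) : Type := PiLp 2 (fun _ : Fin N => Profile n)

variable {N : ℕ} {n : Fin N → ℕ}

/-- The profile `(y, x_{-i})`: the action of player `i` in `x` is replaced by `y`. -/
def deviate (x : Profile n) (i : Fin N) (y : Action n i) : Profile n :=
  WithLp.toLp 2 (Function.update x.ofLp i y)

/-- `x` is a Nash equilibrium of the game with costs `J i` and action sets `ℝ^{n_i}`. -/
def IsNash (J : Fin N → Profile n → ℝ) (x : Profile n) : Prop :=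
  ∀ (i : Fin N) (y : Action n i), J i x ≤ J i (deviate x i y)

/-- The partial gradient `∇_{x_i} J_i (x)`. -/
def partialGrad (J : Fin N → Profile n → ℝ) (i : Fin N) (x : Profile n) : Action n i :=
  gradient (fun y : Action n i => J i (deviate x i y)) (x i)

/-- The pseudo-gradient `F(x) = (∇_{x_i} J_i (x))_i`. -/
def pseudoGrad (J : Fin N → Profile n → ℝ) (x : Profile n) : Profile n :=
  WithLp.toLp 2 fun i => partialGrad J i x

/-- The extended pseudo-gradient `𝐅(𝐱) = (∇_{x_i} J_i (𝐱^i))_i`. -/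
def extPseudoGrad (J : Fin N → Profile n → ℝ) (x : Stack n) : Profile n :=
  WithLp.toLp 2 fun i => partialGrad J i (x i)

/-- The map `ℛᵀ`: `(ℛᵀ x)^i_i = x_i` and `(ℛᵀ x)^i_j = 0` for `j ≠ i`. -/
def selT (x : Profile n) : Stack n :=
  WithLp.toLp 2 fun i => deviate 0 i (x i)

/-- The consensus vector `𝟏_N ⊗ x`. -/
def consensus (x : Profile n) : Stack n :=
  WithLp.toLp 2 fun _ => x

/-- Every cost is `C¹`, and convex and radially unbounded in the player's own action,
whatever the actions of the others. -/
structure RegularCosts (J : Fin N → Profile n → ℝ) : Prop where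
  contDiff : ∀ i, ContDiff ℝ 1 (J i)
  convex : ∀ i x, ConvexOn ℝ Set.univ (fun y : Action n i => J i (deviate x i y))
  radiallyUnbounded : ∀ i x,
    Tendsto (fun y : Action n i => J i (deviate x i y)) (Bornology.cobounded (Action n i)) atTop

/-- The pseudo-gradient is monotone. -/
def MonotonePseudoGrad (J : Fin N → Profile n → ℝ) : Prop :=
  ∀ x x' : Profile n, 0 ≤ inner ℝ (x - x') (pseudoGrad J x - pseudoGrad J x')

/-- The extended pseudo-gradient is monotone:
`⟨𝐱 - 𝐱', ℛᵀ(𝐅(𝐱) - 𝐅(𝐱'))⟩ ≥ 0` for all `𝐱, 𝐱'`. -/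
def MonotoneExtPseudoGrad (J : Fin N → Profile n → ℝ) : Prop :=
  ∀ x x' : Stack n, 0 ≤ inner ℝ (x - x') (selT (extPseudoGrad J x - extPseudoGrad J x'))

/-- `W` is a symmetric weighted adjacency matrix of the undirected graph `G`. -/
structure IsWeightedAdj (G : SimpleGraph (Fin N)) (W : Matrix (Fin N) (Fin N) ℝ) : Prop where
  symm : W.IsSymm
  pos : ∀ i j, G.Adj i j → 0 < W i j
  zero : ∀ i j, ¬ G.Adj i j → W i j = 0

/-- The weighted Laplacian `L = Deg - W`. -/
def laplacian (W : Matrix (Fin N) (Fin N) ℝ) : Matrix (Fin N) (Fin N) ℝ :=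
  Matrix.diagonal (fun i => ∑ j, W i j) - W

/-- The map `𝐋 = L ⊗ I_n` on stacked estimates, blockwise `(𝐋 𝐱)^i = ∑_j L_{ij} 𝐱^j`. -/
def bigLaplacian (W : Matrix (Fin N) (Fin N) ℝ) (x : Stack n) : Stack n :=
  WithLp.toLp 2 fun i => ∑ j, laplacian W i j • x j

/-- `(𝐱(t), 𝐫(t))`, `t ≥ 0`, is a (classical) solution of the distributed Heavy Anchor dynamics
`𝐫' = α (𝐱 - 𝐫)`, `𝐱' = -ℛᵀ 𝐅(𝐱) - β (𝐱 - 𝐫) - c 𝐋 𝐱` (one-sided derivatives at `t = 0`). -/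
def IsSolution (J : Fin N → Profile n → ℝ) (W : Matrix (Fin N) (Fin N) ℝ) (α β c : ℝ)
    (x r : ℝ → Stack n) : Prop :=
  ∀ t : ℝ, 0 ≤ t →
    HasDerivWithinAt r (α • (x t - r t)) (Set.Ici 0) t ∧
    HasDerivWithinAt x
      (-selT (extPseudoGrad J (x t)) - β • (x t - r t) - c • bigLaplacian W (x t)) (Set.Ici 0) t

end

end HeavyAnchor

open HeavyAnchor

/-! Put `B 𝐱 = ℛᵀ𝐅(𝐱) + c 𝐋𝐱`. The dynamics become `r' = α(x - r)`, `x' = -B x - β(x - r)`, with `B`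
continuous and monotone, since `𝐋` is positive semidefinite.

Solutions exist globally although `B` need not be locally Lipschitz: monotonicity makes the field
one-sided Lipschitz, so Grönwall's inequality bounds approximate solutions and makes them uniformly
Cauchy.

For convergence, take a zero `z` of `B`. The function `‖x - z‖² + (β/α)‖r - z‖²` has derivative
`-2⟨x - z, B x⟩ - 2β‖x - r‖² ≤ 0`. Barbalat's lemma gives `x - r → 0`; applied again, to `x - r`
itself, it gives `B x → 0`. A limit point of the bounded trajectory is therefore a zero, and the
Lyapunov function centred there forces the whole trajectory to converge
(`IsHeavyAnchorCurve.exists_tendsto`).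

A zero exists because extended monotonicity decouples the players
(`MonotoneExtPseudoGrad.partialGrad_congr`): minimizers found player by player form a common
critical profile. Comparing any zero of `B` with this one annihilates the Laplacian form, so every
zero is a consensus on a critical profile, which is Nash by convexity. -/

/-! ### Global existence for continuous one-sided Lipschitz fields -/

open Set Metric in
/-- Grönwall's inequality for the squared norm of a curve. -/
theorem norm_sq_le_gronwallBound {E : Type*} [NormedAddCommGroup E] [InnerProductSpace ℝ E]
    {d d' : ℝ → E} {K ε T : ℝ}
    (hd : ∀ t ∈ Icc 0 T, HasDerivWithinAt d (d' t) (Icc 0 T) t)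
    (hb : ∀ t ∈ Icc 0 T, 2 * inner ℝ (d t) (d' t) ≤ K * ‖d t‖ ^ 2 + ε) :
    ∀ t ∈ Icc 0 T, ‖d t‖ ^ 2 ≤ gronwallBound (‖d 0‖ ^ 2) K ε t := by
  have hD : ∀ t ∈ Icc 0 T, HasDerivWithinAt (fun s => ‖d s‖ ^ 2) (2 * inner ℝ (d t) (d' t))
      (Icc 0 T) t := fun t ht => (hd t ht).norm_sq
  intro t ht
  have := le_gronwallBound_of_liminf_deriv_right_le (f := fun s => ‖d s‖ ^ 2)
    (f' := fun t => 2 * inner ℝ (d t) (d' t)) (δ := ‖d 0‖ ^ 2) (K := K) (ε := ε) (a := 0) (b := T)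
    (HasDerivWithinAt.continuousOn hD)
    (fun x hx r hr => by
      have h : HasDerivWithinAt _ _ (Ici x) x :=
        (hD x (Ico_subset_Icc_self hx)).mono_of_mem_nhdsWithin
          (mem_of_superset (Icc_mem_nhdsGE hx.2) (Icc_subset_Icc_left hx.1))
      exact h.liminf_right_slope_le hr)
    le_rfl (fun x hx => hb x (Ico_subset_Icc_self hx)) t ht
  simpa using this

open Set Metric in
/-- A bounded continuous vector field on a finite-dimensional space has approximate integral
curves on any bounded time interval. -/
theorem exists_approx_integralCurve {E : Type*} [NormedAddCommGroup E] [NormedSpace ℝ E]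
    [FiniteDimensional ℝ E] {f : E → E} (hf : Continuous f) {M : ℝ} (hM : ∀ x, ‖f x‖ ≤ M)
    (u₀ : E) {T ε : ℝ} (hT : 0 ≤ T) (hε : 0 < ε) :
    ∃ u u' : ℝ → E, u 0 = u₀ ∧ ∀ t ∈ Icc 0 T,
      HasDerivWithinAt u (u' t) (Icc 0 T) t ∧ ‖u' t - f (u t)‖ ≤ ε := by
  obtain ⟨g, hg, hgf, -⟩ := hf.exists_contDiff_approx 1 (ε := fun _ => ε) continuous_const
    fun _ => hε
  have hM0 : 0 ≤ M := (norm_nonneg _).trans (hM 0)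
  have hgM : ∀ x, ‖g x‖ ≤ M + ε := fun x => by
    have h1 := hgf x
    rw [dist_eq_norm] at h1
    have h2 := norm_add_le (g x - f x) (f x)
    rw [sub_add_cancel] at h2
    linarith [hM x]
  -- At speed at most `M + ε`, no curve leaves this ball before time `T`, so Picard–Lindelöf covers
  -- the whole interval.
  set a : NNReal := ⟨(M + ε) * T, by positivity⟩ with ha
  obtain ⟨K, hK⟩ := (hg.contDiffOn (s := closedBall u₀ a)).exists_lipschitzOnWith one_ne_zero
    (convex_closedBall u₀ a) (isCompact_closedBall u₀ a)
  have hPL : IsPicardLindelof (fun _ => g) (tmin := 0) (tmax := T) ⟨0, le_rfl, hT⟩ u₀ a 0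
      ⟨M + ε, by positivity⟩ K :=
    { lipschitzOnWith := fun _ _ => hK
      continuousOn := fun _ _ => continuousOn_const
      norm_le := fun _ _ x _ => hgM x
      mul_max_le := by
        change (M + ε) * max (T - 0) (0 - 0) ≤ (M + ε) * T - 0
        simp [hT] }
  obtain ⟨u, hu0, hu⟩ := hPL.exists_eq_forall_mem_Icc_hasDerivWithinAt₀
  refine ⟨u, fun t => g (u t), hu0, fun t ht => ⟨hu t ht, ?_⟩⟩
  rw [← dist_eq_norm]
  exact (hgf _).le

/-- The vector field `f` satisfies a one-sided Lipschitz condition with constant `K`. -/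
def OneSidedLipschitz {E : Type*} [NormedAddCommGroup E] [InnerProductSpace ℝ E]
    (K : ℝ) (f : E → E) : Prop :=
  ∀ x y, inner ℝ (x - y) (f x - f y) ≤ K * ‖x - y‖ ^ 2

section OneSided

variable {E : Type*} [NormedAddCommGroup E] [InnerProductSpace ℝ E]

open Set Metric in
/-- Approximate integral curves of a one-sided Lipschitz continuous vector field, all staying in
one ball. -/
theorem OneSidedLipschitz.exists_approx_integralCurve [FiniteDimensional ℝ E] {f : E → E} {K : ℝ}
    (hK : 0 ≤ K) (hfK : OneSidedLipschitz K f) (hf : Continuous f) (u₀ : E) {T : ℝ} (hT : 0 ≤ T) :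
    ∃ ρ : ℝ, ∀ ε : ℝ, 0 < ε → ε ≤ 1 → ∃ u u' : ℝ → E, u 0 = u₀ ∧ ∀ t ∈ Icc 0 T,
      HasDerivWithinAt u (u' t) (Icc 0 T) t ∧ ‖u' t - f (u t)‖ ≤ ε ∧ ‖u t‖ ≤ ρ := by
  set b : ℝ := ‖f 0‖ + 1 with hb
  -- The a priori bound on `‖u‖²`. It depends neither on `ε ≤ 1` nor on the truncation radius, so
  -- the radius `D + 1` can be chosen from it.
  set D : ℝ := gronwallBound (‖u₀‖ ^ 2) (2 * K + 1) (b ^ 2) T with hD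
  have hD0 : 0 ≤ D := by
    have h := gronwallBound_mono (δ := ‖u₀‖ ^ 2) (K := 2 * K + 1) (ε := b ^ 2) (by positivity)
      (by positivity) (by positivity) hT
    rw [gronwallBound_x0] at h
    exact (by positivity : (0 : ℝ) ≤ ‖u₀‖ ^ 2).trans h
  set ρ : ℝ := D + 1 with hρ
  have hρ0 : 0 < ρ := by positivity
  -- `x ↦ s x • x` retracts radially onto the ball of radius `ρ`, making the field bounded. Dividing
  -- the one-sided estimate by `s x` shows that truncation preserves the growth bound.
  set s : E → ℝ := fun x => ρ / max ρ ‖x‖ with hs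
  have hmax : ∀ x : E, 0 < max ρ ‖x‖ := fun x => lt_max_of_lt_left hρ0
  have hs0 : ∀ x, 0 < s x := fun x => div_pos hρ0 (hmax x)
  have hs1 : ∀ x, s x ≤ 1 := fun x => (div_le_one (hmax x)).2 (le_max_left _ _)
  have hsρ : ∀ x, ‖s x • x‖ ≤ ρ := fun x => by
    rw [norm_smul, Real.norm_of_nonneg (hs0 x).le, hs, div_mul_eq_mul_div, div_le_iff₀ (hmax x)]
    exact mul_le_mul_of_nonneg_left (le_max_right _ _) hρ0.le
  have hsc : Continuous s := continuous_const.div (by fun_prop) fun x => (hmax x).ne'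
  have hgc : Continuous fun x => f (s x • x) := hf.comp (hsc.smul continuous_id)
  obtain ⟨M, hM⟩ := (isCompact_closedBall (0 : E) ρ).exists_bound_of_continuousOn hf.continuousOn
  refine ⟨ρ, fun ε hε hε1 => ?_⟩
  obtain ⟨u, u', hu0, hu⟩ := _root_.exists_approx_integralCurve hgc
    (fun x => hM _ (by simpa using hsρ x)) u₀ hT hε
  have hin : ∀ x : E, inner ℝ x (f (s x • x)) ≤ K * ‖x‖ ^ 2 + ‖x‖ * ‖f 0‖ := fun x => by
    have h1 := hfK (s x • x) 0
    rw [sub_zero, inner_smul_left, norm_smul, Real.norm_of_nonneg (hs0 x).le, inner_sub_right]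
      at h1
    have h2 : s x * (inner ℝ x (f (s x • x)) - inner ℝ x (f 0)) ≤ s x * (K * s x * ‖x‖ ^ 2) := by
      simp only [conj_trivial] at h1
      linarith
    have h3 := le_of_mul_le_mul_left h2 (hs0 x)
    have h4 : K * s x * ‖x‖ ^ 2 ≤ K * 1 * ‖x‖ ^ 2 := by gcongr; exact hs1 x
    have h5 := real_inner_le_norm x (f 0)
    linarith
  have hbound : ∀ t ∈ Icc 0 T, ‖u t‖ ^ 2 ≤ D := fun t ht => by
    have h := norm_sq_le_gronwallBound (K := 2 * K + 1) (ε := b ^ 2) (fun t ht => (hu t ht).1)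
      (fun t ht => by
        have h1 := hin (u t)
        have h2 := real_inner_le_norm (u t) (u' t - f (s (u t) • u t))
        rw [inner_sub_right] at h2
        have h3 : ‖u t‖ * ‖u' t - f (s (u t) • u t)‖ ≤ ‖u t‖ * 1 := by
          gcongr; exact (hu t ht).2.trans hε1
        nlinarith [sq_nonneg (‖u t‖ - b)]) t ht
    rw [hu0] at h
    exact h.trans (gronwallBound_mono (by positivity) (by positivity) (by positivity) ht.2)
  have hball : ∀ t ∈ Icc 0 T, ‖u t‖ ≤ ρ := fun t ht => by
    have := hbound t ht
    nlinarith [norm_nonneg (u t), sq_nonneg (‖u t‖ - 1)]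
  refine ⟨u, u', hu0, fun t ht => ⟨(hu t ht).1, ?_, hball t ht⟩⟩
  -- The curve stays where the truncation is inactive.
  have hst : s (u t) = 1 := by rw [hs]; simp [max_eq_left (hball t ht), hρ0.ne']
  simpa [hst] using (hu t ht).2

open Set in
/-- Two integral curves of a one-sided Lipschitz vector field which agree at `0` agree later. -/
theorem OneSidedLipschitz.eqOn {f : E → E} {K : ℝ} (hfK : OneSidedLipschitz K f) {u v : ℝ → E}
    {T : ℝ} (hu : ∀ t ∈ Icc 0 T, HasDerivWithinAt u (f (u t)) (Icc 0 T) t)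
    (hv : ∀ t ∈ Icc 0 T, HasDerivWithinAt v (f (v t)) (Icc 0 T) t) (h0 : u 0 = v 0) :
    EqOn u v (Icc 0 T) := by
  intro t ht
  have := norm_sq_le_gronwallBound (K := 2 * K) (ε := 0) (fun t ht => (hu t ht).sub (hv t ht))
    (fun t ht => by have := hfK (u t) (v t); simp only [Pi.sub_apply]; linarith) t ht
  simp only [Pi.sub_apply, h0, sub_self, norm_zero] at this
  rw [zero_pow two_ne_zero, gronwallBound_ε0_δ0] at this
  have h2 : ‖u t - v t‖ = 0 := by nlinarith [sq_nonneg ‖u t - v t‖]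
  exact sub_eq_zero.1 (norm_eq_zero.1 h2)

open Set Metric in
/-- A continuous one-sided Lipschitz vector field has integral curves on bounded intervals. -/
theorem OneSidedLipschitz.exists_integralCurve_Icc [FiniteDimensional ℝ E] {f : E → E} {K : ℝ}
    (hK : 0 ≤ K) (hfK : OneSidedLipschitz K f) (hf : Continuous f) (u₀ : E) {T : ℝ} (hT : 0 ≤ T) :
    ∃ u : ℝ → E, u 0 = u₀ ∧ ∀ t ∈ Icc 0 T, HasDerivWithinAt u (f (u t)) (Icc 0 T) t := by
  obtain ⟨ρ, hρ⟩ := hfK.exists_approx_integralCurve hK hf u₀ hT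
  obtain ⟨M, hM⟩ := (isCompact_closedBall (0 : E) ρ).exists_bound_of_continuousOn hf.continuousOn
  set ε : ℕ → ℝ := fun k => 1 / ((k : ℝ) + 1) with hε
  have hε0 : ∀ k, 0 < ε k := fun k => by positivity
  have hεt : Tendsto ε atTop (𝓝 0) := tendsto_one_div_add_atTop_nhds_zero_nat
  have hε1 : ∀ k, ε k ≤ 1 := fun k => (div_le_one (by positivity)).2 (by simp)
  choose u u' hu0 hu using fun k => hρ (ε k) (hε0 k) (hε1 k)
  set a : ℝ := 2 * K + 1 with ha
  have ha0 : 0 < a := by positivity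
  set C : ℝ := 1 / a * (Real.exp (a * T) - 1) with hC
  have hC0 : 0 ≤ C := mul_nonneg (by positivity) (by
    have := Real.one_le_exp (x := a * T) (by positivity)
    linarith)
  -- Young's inequality on the error term turns `2K` into `a = 2K + 1`; equal initial values leave
  -- only the forcing term in Grönwall's bound.
  have hdist : ∀ k m, ∀ t ∈ Icc 0 T, ‖u k t - u m t‖ ^ 2 ≤ (ε k + ε m) ^ 2 * C := by
    intro k m t ht
    have h := norm_sq_le_gronwallBound (K := a) (ε := (ε k + ε m) ^ 2)
      (fun t ht => (hu k t ht).1.sub (hu m t ht).1)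
      (fun t ht => by
        simp only [Pi.sub_apply]
        have h1 := hfK (u k t) (u m t)
        have h2 := real_inner_le_norm (u k t - u m t)
          ((u' k t - f (u k t)) - (u' m t - f (u m t)))
        have h3 : ‖u k t - u m t‖ * ‖(u' k t - f (u k t)) - (u' m t - f (u m t))‖
            ≤ ‖u k t - u m t‖ * (ε k + ε m) := by
          gcongr
          exact (norm_sub_le _ _).trans (add_le_add (hu k t ht).2.1 (hu m t ht).2.1)
        have h4 : u' k t - u' m t = (f (u k t) - f (u m t))
          + ((u' k t - f (u k t)) - (u' m t - f (u m t))) := by abel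
        rw [h4, inner_add_right]
        nlinarith [sq_nonneg (‖u k t - u m t‖ - (ε k + ε m))]) t ht
    refine h.trans ?_
    simp only [Pi.sub_apply, hu0, sub_self, norm_zero]
    refine (gronwallBound_mono (by positivity) (by positivity) ha0.le ht.2).trans ?_
    rw [gronwallBound_of_K_ne_0 ha0.ne']
    simp only [hC]
    exact le_of_eq (by ring)
  have hcau : UniformCauchySeqOn u atTop (Icc 0 T) := by
    rw [Metric.uniformCauchySeqOn_iff]
    intro δ hδ
    have h2 : Tendsto (fun k => (ε k + ε k) ^ 2 * C) atTop (𝓝 0) := by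
      simpa using ((hεt.add hεt).pow 2).mul_const C
    obtain ⟨n₀, hn₀⟩ := (h2.eventually (gt_mem_nhds (show 0 < δ ^ 2 by positivity))).exists
    refine ⟨n₀, fun k hk m hm t ht => ?_⟩
    have hanti : ∀ j, n₀ ≤ j → ε j ≤ ε n₀ := fun j hj => one_div_le_one_div_of_le (by positivity)
      (by have : (n₀ : ℝ) ≤ j := by exact_mod_cast hj
          linarith)
    rw [dist_eq_norm]
    refine lt_of_pow_lt_pow_left₀ 2 hδ.le ((hdist k m t ht).trans_lt (lt_of_le_of_lt ?_ hn₀))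
    have := hanti k hk
    have := hanti m hm
    have := hε0 k
    have := hε0 m
    gcongr
  have hlim : ∀ t ∈ Icc 0 T, ∃ y, Tendsto (fun k => u k t) atTop (𝓝 y) := fun t ht =>
    cauchySeq_tendsto_of_complete (hcau.cauchySeq ht)
  choose! v hv using hlim
  have hunif := hcau.tendstoUniformlyOn_of_tendsto hv
  have huc : ∀ k, ContinuousOn (u k) (Icc 0 T) := fun k =>
    HasDerivWithinAt.continuousOn fun t ht => (hu k t ht).1
  have hvc : ContinuousOn v (Icc 0 T) := hunif.continuousOn (Eventually.of_forall huc).frequently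
  have hfc : ContinuousOn (Function.uncurry fun _ : ℝ => f) (Icc 0 T ×ˢ univ) :=
    (hf.comp continuous_snd).continuousOn
  have h0T : (0 : ℝ) ∈ Icc 0 T := ⟨le_rfl, hT⟩
  -- The limit solves the integral equation: the defect of `u k` has derivative at most `ε k`, and
  -- dominated convergence passes to the limit in the integral.
  have hP : ∀ t ∈ Icc 0 T, v t = ODE.picard (fun _ => f) 0 u₀ v t := by
    intro t ht
    have h1 : Tendsto (fun k => u k t - ODE.picard (fun _ => f) 0 u₀ (u k) t) atTop (𝓝 0) := by
      refine squeeze_zero_norm (a := fun k => ε k * T) (fun k => ?_) (by simpa using hεt.mul_const T)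
      have h := (convex_Icc (0 : ℝ) T).norm_image_sub_le_of_norm_hasDerivWithin_le
        (f := fun t => u k t - ODE.picard (fun _ => f) 0 u₀ (u k) t)
        (fun t ht => (hu k t ht).1.sub (ODE.hasDerivWithinAt_picard_Icc h0T hfc (huc k)
          (fun _ _ => mem_univ _) u₀ ht)) (fun t ht => (hu k t ht).2.1) h0T ht
      simp only [hu0, ODE.picard_apply₀, sub_self, sub_zero] at h
      refine h.trans ?_
      rw [Real.norm_of_nonneg ht.1]
      exact mul_le_mul_of_nonneg_left ht.2 (hε0 k).le
    have hsub : uIoc 0 t ⊆ Icc 0 T := by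
      rw [uIoc_of_le ht.1]
      exact Ioc_subset_Icc_self.trans (Icc_subset_Icc_right ht.2)
    have h2 : Tendsto (fun k => ODE.picard (fun _ => f) 0 u₀ (u k) t) atTop
        (𝓝 (ODE.picard (fun _ => f) 0 u₀ v t)) := by
      simp only [ODE.picard_apply]
      refine tendsto_const_nhds.add ?_
      refine intervalIntegral.tendsto_integral_filter_of_dominated_convergence (fun _ => M)
        (Eventually.of_forall fun k => ?_) (Eventually.of_forall fun k => ?_) (by simp) ?_
      · exact ((hf.comp_continuousOn (huc k)).mono hsub).aestronglyMeasurable measurableSet_uIoc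
      · exact Eventually.of_forall fun x hx => hM _ (by simpa using (hu k x (hsub hx)).2.2)
      · exact Eventually.of_forall fun x hx => (hf.tendsto _).comp (hv x (hsub hx))
    have h3 := h1.add h2
    simp only [sub_add_cancel, zero_add] at h3
    exact tendsto_nhds_unique (hv t ht) h3
  refine ⟨v, ?_, fun t ht => ?_⟩
  · rw [hP 0 h0T, ODE.picard_apply₀]
  · exact (ODE.hasDerivWithinAt_picard_Icc h0T hfc hvc (fun _ _ => mem_univ _) u₀ ht).congr hP
      (hP t ht)

open Set in
/-- A continuous one-sided Lipschitz vector field has integral curves on `[0, ∞)`. -/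
theorem OneSidedLipschitz.exists_integralCurve_Ici [FiniteDimensional ℝ E] {f : E → E} {K : ℝ}
    (hK : 0 ≤ K) (hfK : OneSidedLipschitz K f) (hf : Continuous f) (u₀ : E) :
    ∃ u : ℝ → E, u 0 = u₀ ∧ ∀ t, 0 ≤ t → HasDerivWithinAt u (f (u t)) (Ici 0) t := by
  choose v hv0 hv using fun k : ℕ => hfK.exists_integralCurve_Icc hK hf u₀ (Nat.cast_nonneg k)
  have heq : ∀ k m : ℕ, k ≤ m → EqOn (v k) (v m) (Icc 0 (k : ℝ)) := fun k m hkm =>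
    hfK.eqOn (hv k) (fun t ht => by
      have hs : Icc (0 : ℝ) k ⊆ Icc 0 (m : ℝ) := Icc_subset_Icc_right (by exact_mod_cast hkm)
      exact (hv m t (hs ht)).mono hs) (by rw [hv0, hv0])
  set u : ℝ → E := fun t => v ⌈t⌉₊ t with hu
  have hueq : ∀ k : ℕ, EqOn u (v k) (Icc 0 (k : ℝ)) := fun k t ht =>
    heq _ _ (Nat.ceil_le.2 ht.2) ⟨ht.1, Nat.le_ceil t⟩
  refine ⟨u, by simp [hu, hv0], fun t ht => ?_⟩
  -- The strict inequality makes `[0, k]` a neighbourhood of `t` within `[0, ∞)`.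
  obtain ⟨k, hk⟩ := exists_nat_gt t
  have htk : t ∈ Icc (0 : ℝ) k := ⟨ht, hk.le⟩
  have h := (hv k t htk).congr (hueq k) (hueq k htk)
  rw [← hueq k htk] at h
  refine h.mono_of_mem_nhdsWithin ?_
  rw [← Ici_inter_Iic]
  exact inter_mem self_mem_nhdsWithin (mem_nhdsWithin_of_mem_nhds (Iic_mem_nhds hk))

end OneSided

/-! ### Asymptotics of real-variable curves -/

open Set in
/-- Barbalat's lemma: if a curve converges and its derivative is uniformly continuous, then the
derivative tends to zero. -/
theorem tendsto_deriv_zero_of_uniformContinuousOn {F : Type*} [NormedAddCommGroup F]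
    [NormedSpace ℝ F] {f f' : ℝ → F} {l : F}
    (hf : ∀ t, 0 ≤ t → HasDerivWithinAt f (f' t) (Ici 0) t)
    (hf' : UniformContinuousOn f' (Ici 0)) (hl : Tendsto f atTop (𝓝 l)) :
    Tendsto f' atTop (𝓝 0) := by
  rw [Metric.tendsto_nhds]
  intro ε hε
  obtain ⟨δ, hδ, h⟩ := Metric.uniformContinuousOn_iff.1 hf' (ε / 2) (by positivity)
  have hshift : Tendsto (fun t => f (t + δ / 2) - f t) atTop (𝓝 0) := by
    simpa using (hl.comp (tendsto_atTop_add_const_right atTop (δ / 2) tendsto_id)).sub hl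
  filter_upwards [Metric.tendsto_nhds.1 hshift (δ / 2 * (ε / 2)) (by positivity),
    eventually_ge_atTop 0] with t ht ht0
  rw [dist_zero_right] at ht ⊢
  have hsub : Icc t (t + δ / 2) ⊆ Ici 0 := fun s hs => ht0.trans hs.1
  -- The mean value inequality for `f s - s • f' t` compares the increment of `f` with `(δ / 2) • f'
  -- t`; the half keeps distances strictly below `δ`.
  have hmv := (convex_Icc t (t + δ / 2)).norm_image_sub_le_of_norm_hasDerivWithin_le
    (f := fun s => f s - s • f' t) (f' := fun s => f' s - (1 : ℝ) • f' t) (C := ε / 2)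
    (x := t) (y := t + δ / 2)
    (fun s hs => ((hf s (hsub hs)).mono hsub).sub ((hasDerivWithinAt_id s _).smul_const _))
    (fun s hs => by
      rw [one_smul, ← dist_eq_norm]
      refine (h s (hsub hs) t ht0 ?_).le
      rw [Real.dist_eq, abs_of_nonneg (by linarith [hs.1])]
      linarith [hs.2])
    ⟨le_rfl, by linarith⟩ ⟨by linarith, le_rfl⟩
  have e1 : f (t + δ / 2) - (t + δ / 2) • f' t - (f t - t • f' t)
      = (f (t + δ / 2) - f t) - (δ / 2) • f' t := by
    rw [add_smul]; abel
  rw [e1, add_sub_cancel_left, Real.norm_of_nonneg (by positivity : (0 : ℝ) ≤ δ / 2)] at hmv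
  have h2 := norm_sub_norm_le ((δ / 2) • f' t) (f (t + δ / 2) - f t)
  rw [norm_sub_rev ((δ / 2) • f' t), norm_smul,
    Real.norm_of_nonneg (by positivity : (0 : ℝ) ≤ δ / 2)] at h2
  have h3 : δ / 2 * ‖f' t‖ < δ / 2 * ε := by linarith
  exact lt_of_mul_lt_mul_left h3 (by positivity)

open Set in
theorem AntitoneOn.exists_tendsto_atTop_of_nonneg {f : ℝ → ℝ} (hf : AntitoneOn f (Ici 0))
    (h0 : ∀ t, 0 ≤ f t) : ∃ l, Tendsto f atTop (𝓝 l) := by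
  have hanti : Antitone fun t => f (max t 0) := fun s t hst =>
    hf (le_max_right s 0) (le_max_right t 0) (max_le_max_right 0 hst)
  refine ⟨_, (tendsto_atTop_ciInf hanti ⟨0, ?_⟩).congr' ?_⟩
  · rintro _ ⟨t, rfl⟩
    exact h0 _
  · filter_upwards [eventually_ge_atTop 0] with t ht
    rw [max_eq_left ht]

/-! ### Heavy anchor dynamics of a monotone map -/

section HeavyAnchorDynamics

variable {E : Type*} [NormedAddCommGroup E] [InnerProductSpace ℝ E]

/-- The heavy anchor dynamics `r' = α (x - r)`, `x' = - B x - β (x - r)` on `[0, ∞)`. -/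
def IsHeavyAnchorCurve (B : E → E) (α β : ℝ) (x r : ℝ → E) : Prop :=
  ∀ t : ℝ, 0 ≤ t →
    HasDerivWithinAt r (α • (x t - r t)) (Set.Ici 0) t ∧
    HasDerivWithinAt x (-B (x t) - β • (x t - r t)) (Set.Ici 0) t

/-- The map `B` is monotone in the sense of monotone operators. -/
def IsMonotoneMap (B : E → E) : Prop :=
  ∀ x y, 0 ≤ inner ℝ (x - y) (B x - B y)

/-- On the Euclidean product, `-B` contributes nonpositively to the one-sided estimate and the
linear coupling costs at most `α + β`. -/
theorem IsMonotoneMap.exists_isHeavyAnchorCurve [FiniteDimensional ℝ E] {B : E → E}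
    (hB : IsMonotoneMap B) (hBc : Continuous B) {α β : ℝ} (hα : 0 ≤ α) (hβ : 0 ≤ β) (x₀ r₀ : E) :
    ∃ x r : ℝ → E, IsHeavyAnchorCurve B α β x r ∧ x 0 = x₀ ∧ r 0 = r₀ := by
  set f : WithLp 2 (E × E) → WithLp 2 (E × E) := fun z =>
    WithLp.toLp 2 (-B z.fst - β • (z.fst - z.snd), α • (z.fst - z.snd)) with hf
  have hfc : Continuous f := by fun_prop
  have hfK : OneSidedLipschitz (α + β) f := by
    intro z w
    rw [WithLp.prod_inner_apply, WithLp.prod_norm_sq_eq_of_L2]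
    change inner ℝ (z.fst - w.fst)
        (-B z.fst - β • (z.fst - z.snd) - (-B w.fst - β • (w.fst - w.snd)))
      + inner ℝ (z.snd - w.snd) (α • (z.fst - z.snd) - α • (w.fst - w.snd))
      ≤ (α + β) * (‖z.fst - w.fst‖ ^ 2 + ‖z.snd - w.snd‖ ^ 2)
    have e1 : -B z.fst - β • (z.fst - z.snd) - (-B w.fst - β • (w.fst - w.snd))
        = -(B z.fst - B w.fst) - β • ((z.fst - w.fst) - (z.snd - w.snd)) := by
      module
    have e2 : α • (z.fst - z.snd) - α • (w.fst - w.snd)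
        = α • ((z.fst - w.fst) - (z.snd - w.snd)) := by module
    rw [e1, e2]
    have hm := hB z.fst w.fst
    generalize z.fst - w.fst = p at *
    generalize z.snd - w.snd = q at *
    simp only [inner_sub_right, inner_smul_right, inner_neg_right, real_inner_self_eq_norm_sq]
      at hm ⊢
    have h1 := real_inner_le_norm p q
    rw [real_inner_comm p q]
    have h2 : inner ℝ p q ≤ ‖p‖ ^ 2 + ‖q‖ ^ 2 := by
      nlinarith [sq_nonneg (‖p‖ - ‖q‖), sq_nonneg ‖p‖, sq_nonneg ‖q‖]
    have h3 := mul_le_mul_of_nonneg_left h2 (add_nonneg hα hβ)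
    have h4 : 0 ≤ β * ‖p‖ ^ 2 := by positivity
    have h5 : 0 ≤ α * ‖q‖ ^ 2 := by positivity
    linarith
  obtain ⟨u, hu0, hu⟩ := hfK.exists_integralCurve_Ici (add_nonneg hα hβ) hfc
    (WithLp.toLp 2 (x₀, r₀))
  refine ⟨fun t => (u t).fst, fun t => (u t).snd, fun t ht => ⟨?_, ?_⟩, by simp [hu0],
    by simp [hu0]⟩
  · exact (WithLp.sndL 2 ℝ E E).hasFDerivAt.comp_hasDerivWithinAt t (hu t ht)
  · exact (WithLp.fstL 2 ℝ E E).hasFDerivAt.comp_hasDerivWithinAt t (hu t ht)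

variable {B : E → E} {α β : ℝ} {x r : ℝ → E}

/-- The weight `β / α` makes the two coupling terms combine into a perfect square. -/
theorem IsHeavyAnchorCurve.hasDerivWithinAt_lyapunov (h : IsHeavyAnchorCurve B α β x r)
    (hα : α ≠ 0) (z : E) {t : ℝ} (ht : 0 ≤ t) :
    HasDerivWithinAt (fun t => ‖x t - z‖ ^ 2 + β / α * ‖r t - z‖ ^ 2)
      (-2 * inner ℝ (x t - z) (B (x t)) - 2 * β * ‖x t - r t‖ ^ 2) (Set.Ici 0) t := by
  have h1 := ((h t ht).2.sub_const z).norm_sq.add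
    (((h t ht).1.sub_const z).norm_sq.const_mul (β / α))
  refine h1.congr_deriv ?_
  have e : x t - r t = (x t - z) - (r t - z) := by abel
  rw [e]
  generalize x t - z = p
  generalize r t - z = q
  rw [← real_inner_self_eq_norm_sq]
  simp only [inner_sub_right, inner_sub_left, inner_smul_right, inner_neg_right,
    real_inner_comm p q]
  field_simp
  ring

open Set in
theorem IsHeavyAnchorCurve.antitoneOn_lyapunov (h : IsHeavyAnchorCurve B α β x r)
    (hB : IsMonotoneMap B) (hα : 0 < α) (hβ : 0 ≤ β) {z : E} (hz : B z = 0) :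
    AntitoneOn (fun t => ‖x t - z‖ ^ 2 + β / α * ‖r t - z‖ ^ 2) (Ici 0) := by
  have hd := fun t (ht : t ∈ Ici (0 : ℝ)) => h.hasDerivWithinAt_lyapunov hα.ne' z ht
  refine antitoneOn_of_hasDerivWithinAt_nonpos (convex_Ici 0)
    (HasDerivWithinAt.continuousOn hd)
    (fun t ht => (hd t (interior_subset ht)).mono interior_subset) (fun t _ => ?_)
  have := hB (x t) z
  rw [hz, sub_zero] at this
  have h2 : 0 ≤ β * ‖x t - r t‖ ^ 2 := by positivity
  linarith

open Set Metric in
/-- Bounded heavy anchor curves are uniformly continuous, also after applying a continuous map. -/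
theorem IsHeavyAnchorCurve.uniformContinuousOn_comp [FiniteDimensional ℝ E]
    (h : IsHeavyAnchorCurve B α β x r) (hBc : Continuous B) {R : ℝ}
    (hR : ∀ t, 0 ≤ t → ‖(x t, r t)‖ ≤ R) {F : Type*} [UniformSpace F] {φ : E × E → F}
    (hφ : Continuous φ) : UniformContinuousOn (fun t => φ (x t, r t)) (Ici 0) := by
  have hK := isCompact_closedBall (0 : E × E) R
  have hfc : Continuous fun z : E × E => (-B z.1 - β • (z.1 - z.2), α • (z.1 - z.2)) := by fun_prop
  obtain ⟨C, hC⟩ := hK.exists_bound_of_continuousOn hfc.continuousOn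
  have hmem : ∀ t ∈ Ici (0 : ℝ), (x t, r t) ∈ closedBall (0 : E × E) R := fun t ht => by
    simpa using hR t ht
  have hlip : LipschitzOnWith C.toNNReal (fun t => (x t, r t)) (Ici 0) :=
    (convex_Ici (0 : ℝ)).lipschitzOnWith_of_nnnorm_hasDerivWithin_le
      (fun t ht => (h t ht).2.prodMk (h t ht).1)
      (fun t ht => by
        rw [← NNReal.coe_le_coe, coe_nnnorm]
        exact (hC _ (hmem t ht)).trans (Real.le_coe_toNNReal C))
  exact (hK.uniformContinuousOn_of_continuous hφ.continuousOn).comp hlip.uniformContinuousOn hmem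

open Set Metric in
/-- Every heavy anchor curve of a continuous monotone map with a zero converges to a zero. -/
theorem IsHeavyAnchorCurve.exists_tendsto [FiniteDimensional ℝ E]
    (h : IsHeavyAnchorCurve B α β x r) (hB : IsMonotoneMap B) (hBc : Continuous B)
    (hα : 0 < α) (hβ : 0 < β) {z : E} (hz : B z = 0) :
    ∃ y, B y = 0 ∧ Tendsto x atTop (𝓝 y) ∧ Tendsto r atTop (𝓝 y) := by
  have hγ : 0 < β / α := by positivity
  have hV0 : ∀ y t, 0 ≤ ‖x t - y‖ ^ 2 + β / α * ‖r t - y‖ ^ 2 := fun y t => by positivity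
  have hVt : ∀ y, B y = 0 → ∃ l, Tendsto (fun t => ‖x t - y‖ ^ 2 + β / α * ‖r t - y‖ ^ 2)
      atTop (𝓝 l) := fun y hy =>
    (h.antitoneOn_lyapunov hB hα hβ.le hy).exists_tendsto_atTop_of_nonneg (hV0 y)
  obtain ⟨R, hR⟩ : ∃ R, ∀ t, 0 ≤ t → ‖(x t, r t)‖ ≤ R := by
    set V := ‖x 0 - z‖ ^ 2 + β / α * ‖r 0 - z‖ ^ 2 with hV
    refine ⟨max (V + 1) (V / (β / α) + 1) + ‖z‖, fun t ht => ?_⟩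
    have hle : ‖x t - z‖ ^ 2 + β / α * ‖r t - z‖ ^ 2 ≤ V :=
      h.antitoneOn_lyapunov hB hα hβ.le hz self_mem_Ici ht ht
    have h1 : ‖x t - z‖ ^ 2 ≤ V := by linarith [mul_nonneg hγ.le (sq_nonneg ‖r t - z‖)]
    have h2 : ‖r t - z‖ ^ 2 ≤ V / (β / α) := by
      rw [le_div_iff₀ hγ]; linarith [sq_nonneg ‖x t - z‖]
    have h3 : ∀ a c : ℝ, a ^ 2 ≤ c → a ≤ c + 1 := fun a c hac => by
      nlinarith [sq_nonneg (a - 1)]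
    have h4 : ∀ a : E, ‖a‖ ≤ ‖a - z‖ + ‖z‖ := fun a => by
      simpa using norm_add_le (a - z) z
    refine max_le ((h4 _).trans ?_) ((h4 _).trans ?_)
    · exact add_le_add_left ((h3 _ _ h1).trans (le_max_left _ _)) _
    · exact add_le_add_left ((h3 _ _ h2).trans (le_max_right _ _)) _
  have hxr : Tendsto (fun t => x t - r t) atTop (𝓝 0) := by
    obtain ⟨l, hl⟩ := hVt z hz
    have hd := tendsto_deriv_zero_of_uniformContinuousOn
      (fun t ht => h.hasDerivWithinAt_lyapunov hα.ne' z ht)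
      (h.uniformContinuousOn_comp hBc hR
        (φ := fun p => -2 * inner ℝ (p.1 - z) (B p.1) - 2 * β * ‖p.1 - p.2‖ ^ 2) (by fun_prop)) hl
    have hsq : Tendsto (fun t => ‖x t - r t‖ ^ 2) atTop (𝓝 0) := by
      refine squeeze_zero (fun t => by positivity) (fun t => ?_)
        (by simpa using hd.const_mul (-1 / (2 * β)))
      have := hB (x t) z
      rw [hz, sub_zero] at this
      rw [div_mul_eq_mul_div, le_div_iff₀ (by positivity)]
      linarith
    rw [tendsto_zero_iff_norm_tendsto_zero]
    simpa using hsq.sqrt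
  -- Monotonicity alone does not give `B x → 0` from `⟨x - z, B x⟩ → 0`; Barbalat's lemma for `x -
  -- r` does.
  have hBx : Tendsto (fun t => B (x t)) atTop (𝓝 0) := by
    have hd := tendsto_deriv_zero_of_uniformContinuousOn
      (fun t ht => (h t ht).2.sub (h t ht).1)
      (h.uniformContinuousOn_comp hBc hR
        (φ := fun p => -B p.1 - β • (p.1 - p.2) - α • (p.1 - p.2)) (by fun_prop)) hxr
    have h2 := hd.neg.sub (hxr.const_smul (β + α))
    simp only [neg_zero, smul_zero, sub_zero] at h2
    refine h2.congr fun t => ?_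
    module
  obtain ⟨⟨y, y'⟩, -, φ, hφ, hlim⟩ := (isCompact_closedBall (0 : E × E) R).tendsto_subseq
    (x := fun k : ℕ => (x k, r k)) (fun k => by simpa using hR k k.cast_nonneg)
  have hφt : Tendsto (fun k => (φ k : ℝ)) atTop atTop :=
    tendsto_natCast_atTop_atTop.comp hφ.tendsto_atTop
  have hx : Tendsto (fun k => x (φ k)) atTop (𝓝 y) := hlim.fst_nhds
  have hr : Tendsto (fun k => r (φ k)) atTop (𝓝 y') := hlim.snd_nhds
  have hyy : y - y' = 0 := tendsto_nhds_unique (hx.sub hr) (hxr.comp hφt)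
  obtain rfl : y = y' := sub_eq_zero.1 hyy
  have hy : B y = 0 := tendsto_nhds_unique ((hBc.tendsto y).comp hx) (hBx.comp hφt)
  -- The Lyapunov function centred at the limit point `y` converges, and its limit is zero along the
  -- subsequence.
  have hV : Tendsto (fun t => ‖x t - y‖ ^ 2 + β / α * ‖r t - y‖ ^ 2) atTop (𝓝 0) := by
    obtain ⟨l, hl⟩ := hVt y hy
    have h0 : Tendsto (fun k => ‖x (φ k) - y‖ ^ 2 + β / α * ‖r (φ k) - y‖ ^ 2) atTop (𝓝 0) := by
      simpa using (((hx.sub_const y).norm.pow 2).add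
        (((hr.sub_const y).norm.pow 2).const_mul (β / α)))
    rwa [tendsto_nhds_unique (hl.comp hφt) h0] at hl
  refine ⟨y, hy, ?_, ?_⟩
  · rw [tendsto_iff_norm_sub_tendsto_zero]
    have : Tendsto (fun t => ‖x t - y‖ ^ 2) atTop (𝓝 0) :=
      squeeze_zero (fun t => by positivity)
        (fun t => le_add_of_nonneg_right (by positivity)) hV
    simpa using this.sqrt
  · rw [tendsto_iff_norm_sub_tendsto_zero]
    have h1 : Tendsto (fun t => β / α * ‖r t - y‖ ^ 2) atTop (𝓝 0) :=
      squeeze_zero (fun t => by positivity)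
        (fun t => le_add_of_nonneg_left (by positivity)) hV
    have : Tendsto (fun t => ‖r t - y‖ ^ 2) atTop (𝓝 0) := by
      have := h1.const_mul (β / α)⁻¹
      simpa [← mul_assoc, inv_mul_cancel₀ hγ.ne', hα.ne', hβ.ne'] using this
    simpa using this.sqrt

end HeavyAnchorDynamics

namespace HeavyAnchor

variable {N : ℕ} {n : Fin N → ℕ}

/-! ### Unilateral deviations -/

section Deviate

@[simp]
theorem deviate_same (x : Profile n) (i : Fin N) (y : Action n i) : deviate x i y i = y := by
  simp [deviate]

@[simp]
theorem deviate_of_ne (x : Profile n) {i j : Fin N} (h : j ≠ i) (y : Action n i) :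
    deviate x i y j = x j := by
  simp [deviate, h]

@[simp]
theorem deviate_self (x : Profile n) (i : Fin N) : deviate x i (x i) = x := by
  simp [deviate]

@[simp]
theorem deviate_deviate (x : Profile n) (i : Fin N) (y y' : Action n i) :
    deviate (deviate x i y) i y' = deviate x i y' := by
  simp [deviate]

/-- The inclusion of the action space of player `i` as a coordinate subspace. -/
noncomputable def coordInclusion (n : Fin N → ℕ) (i : Fin N) : Action n i →L[ℝ] Profile n :=
  (PiLp.continuousLinearEquiv 2 ℝ (Action n)).symm.toContinuousLinearMap.comp
    (ContinuousLinearMap.single ℝ (Action n) i)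

theorem deviate_eq_add (x : Profile n) (i : Fin N) (y : Action n i) :
    deviate x i y = x + coordInclusion n i (y - x i) := by
  ext j : 1
  by_cases h : j = i
  · subst h
    simp [coordInclusion]
  · simp [h, coordInclusion]

theorem hasFDerivAt_deviate (x : Profile n) (i : Fin N) (y : Action n i) :
    HasFDerivAt (deviate x i) (coordInclusion n i) y := by
  have : deviate x i = fun y => x + coordInclusion n i (y - x i) :=
    funext fun y => deviate_eq_add x i y
  rw [this]
  exact ((coordInclusion n i).hasFDerivAt.comp y ((hasFDerivAt_id y).sub_const (x i))).const_add x

theorem continuous_deviate (x : Profile n) (i : Fin N) : Continuous (deviate x i) :=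
  continuous_iff_continuousAt.2 fun y => (hasFDerivAt_deviate x i y).continuousAt

theorem inner_deviate_zero (x : Profile n) (i : Fin N) (y : Action n i) :
    inner ℝ x (deviate 0 i y) = inner ℝ (x i) y := by
  rw [PiLp.inner_apply, Finset.sum_eq_single i (fun j _ h => by simp [h]) (by simp), deviate_same]

end Deviate

/-! ### Critical profiles and decoupling -/

section PseudoGradient

variable {J : Fin N → Profile n → ℝ}

theorem RegularCosts.differentiableAt_deviate (hJ : RegularCosts J) (i : Fin N) (x : Profile n)
    (y : Action n i) : DifferentiableAt ℝ (fun y => J i (deviate x i y)) y :=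
  ((hJ.contDiff i).differentiable one_ne_zero _).comp y (hasFDerivAt_deviate x i y).differentiableAt

theorem RegularCosts.continuous_partialGrad (hJ : RegularCosts J) (i : Fin N) :
    Continuous (partialGrad J i) := by
  have h : partialGrad J i = fun x => (InnerProductSpace.toDual ℝ (Action n i)).symm
      ((fderiv ℝ (J i) x).comp (coordInclusion n i)) := by
    funext x
    unfold partialGrad gradient
    congr 1
    have h1 := ((hJ.contDiff i).differentiable one_ne_zero (deviate x i (x i))).hasFDerivAt
    have h2 := (h1.comp (x i) (hasFDerivAt_deviate x i (x i))).fderiv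
    rwa [deviate_self] at h2
  rw [h]
  have := (hJ.contDiff i).continuous_fderiv one_ne_zero
  fun_prop

/-- Along the segment from `x i` to `y` the cost is convex with zero slope at the start, so it
cannot end lower. -/
theorem RegularCosts.isNash_of_partialGrad_eq_zero (hJ : RegularCosts J) {x : Profile n}
    (h : ∀ i, partialGrad J i x = 0) : IsNash J x := by
  intro i y
  have hd : HasFDerivAt (fun y : Action n i => J i (deviate x i y)) (0 : Action n i →L[ℝ] ℝ)
      (x i) := by
    have := (hJ.differentiableAt_deviate i x (x i)).hasGradientAt.hasFDerivAt
    rwa [show gradient (fun y => J i (deviate x i y)) (x i) = 0 from h i, map_zero] at this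
  set ℓ : ℝ →ᵃ[ℝ] Action n i := AffineMap.lineMap (x i) y with hℓ
  have hc : ConvexOn ℝ Set.univ (fun t : ℝ => J i (deviate x i (ℓ t))) := by
    have h := (hJ.convex i x).comp_affineMap ℓ
    rwa [Set.preimage_univ] at h
  have hℓd : HasDerivAt (fun t => ℓ t) (y - x i) 0 := AffineMap.hasDerivAt_lineMap
  have hd' : HasDerivAt (fun t : ℝ => J i (deviate x i (ℓ t))) 0 0 := by
    have h0 : ℓ 0 = x i := by simp [hℓ]
    rw [← h0] at hd
    simpa using! hd.comp_hasDerivAt (0 : ℝ) hℓd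
  have := hc.le_slope_of_hasDerivAt (Set.mem_univ 0) (Set.mem_univ 1) one_pos hd'
  simpa [slope_def_field, hℓ] using this

theorem RegularCosts.exists_partialGrad_eq_zero (hJ : RegularCosts J) (i : Fin N)
    (x : Profile n) : ∃ y, partialGrad J i (deviate x i y) = 0 := by
  have hc : Continuous fun y => J i (deviate x i y) :=
    (hJ.contDiff i).continuous.comp (continuous_deviate x i)
  obtain ⟨y, hy⟩ := hc.exists_forall_le
    (by simpa [Metric.cobounded_eq_cocompact] using hJ.radiallyUnbounded i x)
  refine ⟨y, ?_⟩
  have hmin : IsLocalMin (fun y => J i (deviate x i y)) y := Eventually.of_forall hy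
  unfold partialGrad gradient
  simp [hmin.fderiv_eq_zero]

theorem inner_selT (x : Stack n) (v : Profile n) :
    inner ℝ x (selT v) = ∑ i, inner ℝ (x i i) (v i) := by
  rw [PiLp.inner_apply]
  exact Finset.sum_congr rfl fun i _ => inner_deviate_zero (x i) i (v i)

theorem selT_sub (v w : Profile n) : selT (v - w) = selT v - selT w := by
  refine ext_inner_left ℝ fun x => ?_
  rw [inner_sub_right]
  simp only [inner_selT, PiLp.sub_apply, inner_sub_right, Finset.sum_sub_distrib]

@[simp]
theorem selT_zero : selT (0 : Profile n) = 0 := by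
  simpa using selT_sub (0 : Profile n) 0

theorem RegularCosts.continuous_selT_extPseudoGrad (hJ : RegularCosts J) :
    Continuous fun x : Stack n => selT (extPseudoGrad J x) := by
  have h : (fun x : Stack n => selT (extPseudoGrad J x)) = fun x =>
      WithLp.toLp 2 fun i => 0 + coordInclusion n i (partialGrad J i (x i) - 0) := by
    funext x
    unfold selT extPseudoGrad
    simp only [deviate_eq_add]
    rfl
  rw [h]
  have := fun i => hJ.continuous_partialGrad i
  fun_prop

/-- Monotonicity of the extended pseudo-gradient decouples the players: the partial gradient of
player `i` depends only on the action of player `i`. -/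
theorem MonotoneExtPseudoGrad.partialGrad_congr (h : MonotoneExtPseudoGrad J)
    (hJ : RegularCosts J) {i : Fin N} {a b : Profile n} (hab : a i = b i) :
    partialGrad J i a = partialGrad J i b := by
  set v := partialGrad J i b - partialGrad J i a with hv
  -- Minty's trick: the two stacks differ only in block `i`, and `a i = b i` leaves `s • v` as the
  -- tested difference. Dividing by `s` and letting `s → 0` yields `0 ≤ -‖v‖²`.
  have key : ∀ s : ℝ, 0 < s →
      0 ≤ inner ℝ v (partialGrad J i (deviate a i (a i + s • v)) - partialGrad J i b) := by
    intro s hs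
    have h1 := h (WithLp.toLp 2 (Pi.single i (deviate a i (a i + s • v))))
      (WithLp.toLp 2 (Pi.single i b))
    rw [inner_selT, Finset.sum_eq_single i (fun j _ hj => by simp [hj]) (by simp)] at h1
    simp only [extPseudoGrad, PiLp.sub_apply, Pi.single_eq_same, deviate_same, hab,
      add_sub_cancel_left, inner_smul_left, conj_trivial] at h1
    rw [hab]
    exact nonneg_of_mul_nonneg_right h1 hs
  have hlim : Tendsto (fun s : ℝ =>
      inner ℝ v (partialGrad J i (deviate a i (a i + s • v)) - partialGrad J i b)) (𝓝[>] 0)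
      (𝓝 (inner ℝ v (partialGrad J i a - partialGrad J i b))) := by
    have hg := hJ.continuous_partialGrad i
    have hd := continuous_deviate a i
    have hc : Continuous fun s : ℝ =>
      inner ℝ v (partialGrad J i (deviate a i (a i + s • v)) - partialGrad J i b) := by fun_prop
    simpa using (hc.tendsto 0).mono_left nhdsWithin_le_nhds
  have h0 := ge_of_tendsto hlim (eventually_mem_nhdsWithin.mono fun s hs => key s hs)
  rw [← neg_sub (partialGrad J i b), ← hv, inner_neg_right, real_inner_self_eq_norm_sq] at h0
  have h1 : ‖v‖ = 0 := by nlinarith [sq_nonneg ‖v‖]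
  exact (sub_eq_zero.1 (norm_eq_zero.1 h1)).symm

/-- Each player minimizes against zero actions of the others; by decoupling, these responses remain
critical when assembled. -/
theorem MonotoneExtPseudoGrad.exists_partialGrad_eq_zero (h : MonotoneExtPseudoGrad J)
    (hJ : RegularCosts J) : ∃ x : Profile n, ∀ i, partialGrad J i x = 0 := by
  choose y hy using fun i => hJ.exists_partialGrad_eq_zero i 0
  exact ⟨WithLp.toLp 2 y, fun i =>
    (h.partialGrad_congr hJ (by simp)).trans (hy i)⟩

end PseudoGradient

/-! ### The Laplacian quadratic form -/

section Laplacian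

variable {G : SimpleGraph (Fin N)} {W : Matrix (Fin N) (Fin N) ℝ}

theorem IsWeightedAdj.nonneg (hW : IsWeightedAdj G W) (i j : Fin N) : 0 ≤ W i j := by
  by_cases h : G.Adj i j
  · exact (hW.pos i j h).le
  · exact (hW.zero i j h).ge

theorem bigLaplacian_apply (W : Matrix (Fin N) (Fin N) ℝ) (x : Stack n) (i : Fin N) :
    bigLaplacian W x i = ∑ j, W i j • (x i - x j) := by
  simp [bigLaplacian, laplacian, Matrix.diagonal_apply, sub_smul, smul_sub,
    Finset.sum_sub_distrib, Finset.sum_smul]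

theorem bigLaplacian_sub (W : Matrix (Fin N) (Fin N) ℝ) (x y : Stack n) :
    bigLaplacian W (x - y) = bigLaplacian W x - bigLaplacian W y := by
  ext i : 1
  simp only [bigLaplacian, PiLp.sub_apply, smul_sub, Finset.sum_sub_distrib]

@[simp]
theorem bigLaplacian_consensus (W : Matrix (Fin N) (Fin N) ℝ) (x : Profile n) :
    bigLaplacian W (consensus x) = 0 := by
  ext i : 1
  rw [bigLaplacian_apply]
  simp [consensus]

theorem continuous_bigLaplacian (W : Matrix (Fin N) (Fin N) ℝ) :
    Continuous (bigLaplacian W : Stack n → Stack n) := by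
  unfold bigLaplacian
  fun_prop

theorem inner_bigLaplacian (hW : W.IsSymm) (x : Stack n) :
    inner ℝ x (bigLaplacian W x) = 1 / 2 * ∑ i, ∑ j, W i j * ‖x i - x j‖ ^ 2 := by
  have h1 : inner ℝ x (bigLaplacian W x) = ∑ i, ∑ j, W i j * inner ℝ (x i) (x i - x j) := by
    simp only [PiLp.inner_apply, bigLaplacian_apply, inner_sum, inner_smul_right]
  have h2 : inner ℝ x (bigLaplacian W x) = ∑ i, ∑ j, W i j * inner ℝ (x j) (x j - x i) := by
    rw [h1, Finset.sum_comm]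
    exact Finset.sum_congr rfl fun i _ => Finset.sum_congr rfl fun j _ => by rw [hW.apply]
  have h3 : ∑ i, ∑ j, W i j * ‖x i - x j‖ ^ 2
      = inner ℝ x (bigLaplacian W x) + inner ℝ x (bigLaplacian W x) := by
    nth_rw 1 [h1]
    rw [h2, ← Finset.sum_add_distrib]
    refine Finset.sum_congr rfl fun i _ => ?_
    rw [← Finset.sum_add_distrib]
    refine Finset.sum_congr rfl fun j _ => ?_
    rw [← mul_add, ← real_inner_self_eq_norm_sq]
    simp only [inner_sub_left, inner_sub_right]
    ring
  rw [h3]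
  ring

theorem IsWeightedAdj.inner_bigLaplacian_nonneg (hW : IsWeightedAdj G W) (x : Stack n) :
    0 ≤ inner ℝ x (bigLaplacian W x) := by
  rw [inner_bigLaplacian hW.symm]
  have := fun i j => mul_nonneg (hW.nonneg i j) (sq_nonneg ‖x i - x j‖)
  exact mul_nonneg (by norm_num) (Finset.sum_nonneg fun i _ => Finset.sum_nonneg fun j _ => this i j)

theorem IsWeightedAdj.exists_eq_consensus (hW : IsWeightedAdj G W) (hG : G.Connected)
    {x : Stack n} (hx : inner ℝ x (bigLaplacian W x) = 0) : ∃ y, x = consensus y := by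
  have h0 := fun i j => mul_nonneg (hW.nonneg i j) (sq_nonneg ‖x i - x j‖)
  have hadj : ∀ i j, G.Adj i j → x i = x j := by
    intro i j hij
    rw [inner_bigLaplacian hW.symm, mul_eq_zero, or_iff_right (by norm_num),
      Finset.sum_eq_zero_iff_of_nonneg fun i _ => Finset.sum_nonneg fun j _ => h0 i j] at hx
    have h1 := (Finset.sum_eq_zero_iff_of_nonneg fun j _ => h0 i j).1 (hx i (Finset.mem_univ i)) j
      (Finset.mem_univ j)
    rw [mul_eq_zero, or_iff_right (hW.pos i j hij).ne', sq_eq_zero_iff, norm_eq_zero] at h1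
    exact sub_eq_zero.1 h1
  have hwalk : ∀ i j, G.Walk i j → x i = x j := fun i j p => by
    induction p with
    | nil => rfl
    | cons h _ ih => exact (hadj _ _ h).trans ih
  obtain ⟨i⟩ := hG.nonempty
  refine ⟨x i, ?_⟩
  ext j : 1
  exact (hG.preconnected j i).elim fun p => hwalk j i p

end Laplacian

/-! ### Zeros of the augmented pseudo-gradient -/

section Dynamics

variable {J : Fin N → Profile n → ℝ} {G : SimpleGraph (Fin N)} {W : Matrix (Fin N) (Fin N) ℝ}
  {α β c : ℝ}

/-- The augmented pseudo-gradient `𝐱 ↦ ℛᵀ 𝐅(𝐱) + c 𝐋 𝐱`. -/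
noncomputable def augPseudoGrad (J : Fin N → Profile n → ℝ) (W : Matrix (Fin N) (Fin N) ℝ) (c : ℝ)
    (x : Stack n) : Stack n :=
  selT (extPseudoGrad J x) + c • bigLaplacian W x

theorem RegularCosts.continuous_augPseudoGrad (hJ : RegularCosts J) :
    Continuous (augPseudoGrad J W c) :=
  hJ.continuous_selT_extPseudoGrad.add ((continuous_bigLaplacian W).const_smul c)

theorem inner_augPseudoGrad_sub (x y : Stack n) :
    inner ℝ (x - y) (augPseudoGrad J W c x - augPseudoGrad J W c y)
      = inner ℝ (x - y) (selT (extPseudoGrad J x - extPseudoGrad J y))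
        + c * inner ℝ (x - y) (bigLaplacian W (x - y)) := by
  rw [selT_sub, bigLaplacian_sub, ← inner_smul_right, ← inner_add_right]
  congr 1
  unfold augPseudoGrad
  module

theorem MonotoneExtPseudoGrad.isMonotoneMap_augPseudoGrad (h : MonotoneExtPseudoGrad J)
    (hW : IsWeightedAdj G W) (hc : 0 ≤ c) : IsMonotoneMap (augPseudoGrad J W c) := fun x y => by
  rw [inner_augPseudoGrad_sub]
  exact add_nonneg (h x y) (mul_nonneg hc (hW.inner_bigLaplacian_nonneg _))

theorem augPseudoGrad_consensus_eq_zero_iff (x : Profile n) :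
    augPseudoGrad J W c (consensus x) = 0 ↔ ∀ i, partialGrad J i x = 0 := by
  have h : augPseudoGrad J W c (consensus x) = selT (pseudoGrad J x) := by
    unfold augPseudoGrad
    rw [bigLaplacian_consensus, smul_zero, add_zero]
    rfl
  rw [h]
  refine ⟨fun h i => ?_, fun h => ?_⟩
  · have := congrArg (fun z : Stack n => z i i) h
    simpa [selT, pseudoGrad] using this
  · have : pseudoGrad J x = 0 := by
      ext i : 1
      exact h i
    rw [this, selT_zero]

/-- Paired with the difference from a known consensus zero, the monotone and Laplacian terms are
nonnegative with sum zero. As `c > 0`, the Laplacian form vanishes, so the difference is a consensus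
vector. -/
theorem MonotoneExtPseudoGrad.exists_isNash_of_augPseudoGrad_eq_zero
    (h : MonotoneExtPseudoGrad J) (hJ : RegularCosts J) (hG : G.Connected)
    (hW : IsWeightedAdj G W) (hc : 0 < c) {x : Stack n} (hx : augPseudoGrad J W c x = 0) :
    ∃ xs, IsNash J xs ∧ x = consensus xs := by
  obtain ⟨y, hy⟩ := h.exists_partialGrad_eq_zero hJ
  have h1 := inner_augPseudoGrad_sub (J := J) (W := W) (c := c) x (consensus y)
  rw [hx, (augPseudoGrad_consensus_eq_zero_iff y).2 hy, sub_zero, inner_zero_right] at h1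
  have h2 := hW.inner_bigLaplacian_nonneg (x - consensus y)
  have h3 : inner ℝ (x - consensus y) (bigLaplacian W (x - consensus y)) = 0 := by
    have := h x (consensus y)
    nlinarith
  obtain ⟨z, hz⟩ := hW.exists_eq_consensus hG h3
  have hxz : x = consensus (z + y) := by
    rw [eq_add_of_sub_eq hz]
    rfl
  refine ⟨z + y, hJ.isNash_of_partialGrad_eq_zero ?_, hxz⟩
  rwa [hxz, augPseudoGrad_consensus_eq_zero_iff] at hx

theorem isSolution_iff {x r : ℝ → Stack n} :
    IsSolution J W α β c x r ↔ IsHeavyAnchorCurve (augPseudoGrad J W c) α β x r := by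
  have h : ∀ t, -selT (extPseudoGrad J (x t)) - β • (x t - r t) - c • bigLaplacian W (x t)
      = -augPseudoGrad J W c (x t) - β • (x t - r t) := fun t => by
    unfold augPseudoGrad
    module
  simp only [IsSolution, IsHeavyAnchorCurve, h]

end Dynamics

end HeavyAnchor

theorem mainTheorem2 {N : ℕ} (n : Fin N → ℕ) (J : Fin N → Profile n → ℝ)
    (hJ : RegularCosts J)
    (hF : MonotonePseudoGrad J)
    (hFext : MonotoneExtPseudoGrad J)
    (G : SimpleGraph (Fin N)) (hG : G.Connected)
    (W : Matrix (Fin N) (Fin N) ℝ) (hW : IsWeightedAdj G W)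
    (α β c : ℝ) (hα : 0 < α) (hβ : 0 < β) (hc : 0 < c) :
    (∀ x₀ r₀ : Stack n, ∃ x r : ℝ → Stack n,
      IsSolution J W α β c x r ∧ x 0 = x₀ ∧ r 0 = r₀) ∧
    (∀ x r : ℝ → Stack n, IsSolution J W α β c x r →
      ∃ xs : Profile n, IsNash J xs ∧
        Tendsto x atTop (𝓝 (consensus xs)) ∧ Tendsto r atTop (𝓝 (consensus xs))) := by
  have hB := hFext.isMonotoneMap_augPseudoGrad hW hc.le
  have hBc := hJ.continuous_augPseudoGrad (W := W) (c := c)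
  simp only [isSolution_iff]
  refine ⟨fun x₀ r₀ => hB.exists_isHeavyAnchorCurve hBc hα.le hβ.le x₀ r₀, fun x r h => ?_⟩
  obtain ⟨y, hy⟩ := hFext.exists_partialGrad_eq_zero hJ
  obtain ⟨z, hz, hx, hr⟩ := h.exists_tendsto hB hBc hα hβ
    ((augPseudoGrad_consensus_eq_zero_iff y).2 hy)
  obtain ⟨xs, hxs, rfl⟩ := hFext.exists_isNash_of_augPseudoGrad_eq_zero hJ hG hW hc hz
  exact ⟨xs, hxs, hx, hr⟩
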